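/- Let $\mathrm{M}$ be a matroid with lattice of flats $\mathcal{L}$: a finite nonempty lattice with least element $\emptyset$, atomic (every element is a join of atoms) and ranked (for each $F$, all maximal chains of $[\emptyset,F]$ have the same length $\operatorname{rk}(F)$), with $\operatorname{rk}(F\vee G)+\operatorname{rk}(F\wedge G)\le \operatorname{rk}(F)+\operatorname{rk}(G)$ for all $F,G$. Put $\overline{\mathcal{L}}=\mathcal{L}\setminus\{\emptyset\}$. The augmented Chow ring of $\mathrm{M}$ is the quotient $A(\mathrm{M})$ of $\mathbb{Z}[h_F : F\in\overline{\mathcal{L}}]$ by the ideal generated by the elements $(h_F-h_{F\vee G})(h_G-h_{F\vee G})$ for $F,G\in\overline{\mathcal{L}}$, and $h_a^2$ and $h_ah_F-h_ah_{F\vee a}$ for $F\in\overline{\mathcal{L}}$ and $a$ an atom. The graded Möbius algebra of $\mathrm{M}$ is the commutative ring $H(\mathrm{M})=\bigoplus_{F\in\mathcal{L}}\mathbb{Z}\,y_F$ with $y_F\cdot y_G=y_{F\vee G}$ if $\operatorname{rk}(F)+\operatorname{rk}(G)=\operatorname{rk}(F\vee G)$ and $y_F\cdot y_G=0$ otherwise.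 Then there is a unique ring homomorphism $\varphi\colon H(\mathrm{M})\to A(\mathrm{M})$ with $\varphi(y_a)=h_a$ for every atom $a$ of $\mathcal{L}$. It is injective, it satisfies $\varphi(y_F)=h_F^{\operatorname{rk}(F)}$ for every $F\in\mathcal{L}$, and the family $(h_F^{\operatorname{rk}(F)})_{F\in\mathcal{L}}$ is a $\mathbb{Z}$-basis of its image, where $h_\emptyset^{\operatorname{rk}(\emptyset)}$ means $1$. -/

import Mathlib

noncomputable section

namespace MatroidChow

universe u

/-- The rank of an element `F` of a finite lattice with bottom: the largest length `n` of a chain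
`⊥ = F₀ < F₁ < ⋯ < Fₙ = F`. -/
def rk {L : Type u} [Lattice L] (F : L) : ℕ := (Order.height F).toNat

/-- A matroid, given by its lattice of flats `L`: a finite nonempty lattice (nonempty because it has
a least element `⊥`, the flat usually denoted `∅`) which is atomic, i.e. every element is a join of
atoms; ranked, i.e. every maximal chain in the interval `[⊥, F]` has the same length, `rk F` (so it
has `rk F + 1` elements); and whose rank function is submodular. -/
class IsMatroidLattice (L : Type u) [Lattice L] [OrderBot L] : Prop extends
    IsAtomistic L where
  finite : Finite L
  ranked : ∀ (F : L) (C : Flag (Set.Iic F)), (C : Set (Set.Iic F)).ncard = rk F + 1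
  submodular : ∀ F G : L, rk (F ⊔ G) + rk (F ⊓ G) ≤ rk F + rk G

section AugmentedChow

variable (L : Type u) [Lattice L] [OrderBot L]

/-- The nonempty flats, i.e. all flats except `⊥`. -/
abbrev NonemptyFlat : Type u := {F : L // F ≠ ⊥}

variable {L}

/-- The join of two nonempty flats, as a nonempty flat. -/
def NonemptyFlat.join (F G : NonemptyFlat L) : NonemptyFlat L :=
  ⟨F.1 ⊔ G.1, fun h => F.2 (sup_eq_bot_iff.mp h).1⟩

variable (L)

/-- The defining relations of the augmented Chow ring, in the polynomial ring over `ℤ` with one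
variable for each nonempty flat. -/
inductive AugmentedChowRel : MvPolynomial (NonemptyFlat L) ℤ → Prop
  | join (F G : NonemptyFlat L) : AugmentedChowRel
      ((MvPolynomial.X F - MvPolynomial.X (G.join F)) *
        (MvPolynomial.X G - MvPolynomial.X (G.join F)))
  | atom_sq (a : NonemptyFlat L) (ha : IsAtom a.1) : AugmentedChowRel (MvPolynomial.X a ^ 2)
  | atom_mul (a : NonemptyFlat L) (ha : IsAtom a.1) (F : NonemptyFlat L) : AugmentedChowRel
      (MvPolynomial.X a * MvPolynomial.X F - MvPolynomial.X a * MvPolynomial.X (F.join a))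

/-- The augmented Chow ring `A(M)`, in its simplicial presentation. -/
abbrev AugmentedChowRing : Type u :=
  MvPolynomial (NonemptyFlat L) ℤ ⧸ Ideal.span {p | AugmentedChowRel L p}

variable {L}

/-- The generator `h_F` of the augmented Chow ring. -/
def h (F : NonemptyFlat L) : AugmentedChowRing L :=
  Ideal.Quotient.mk (Ideal.span {p | AugmentedChowRel L p}) (MvPolynomial.X F)

open scoped Classical in
/-- The element `h_F ^ rk F` of the augmented Chow ring, for every flat `F`. For `F = ⊥` it is the
empty product `1`, as `rk ⊥ = 0`. -/
def hPow (F : L) : AugmentedChowRing L :=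
  if hF : F = ⊥ then 1 else h ⟨F, hF⟩ ^ rk F

end AugmentedChow

section GradedMoebius

/-- The underlying group `⨁_F ℤ y_F` of the graded Möbius algebra `H(M)`. -/
def GradedMoebiusAlgebra (L : Type u) : Type u := L →₀ ℤ

namespace GradedMoebiusAlgebra

instance (L : Type u) : AddCommGroup (GradedMoebiusAlgebra L) :=
  inferInstanceAs (AddCommGroup (L →₀ ℤ))

/-- The basis element `y_F` of the graded Möbius algebra. -/
def y {L : Type u} (F : L) : GradedMoebiusAlgebra L := Finsupp.single F (1 : ℤ)

variable {L : Type u} [Lattice L]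

/-- The bilinear extension of the multiplication rule: `y_F * y_G = y_{F ⊔ G}` if
`rk F + rk G = rk (F ⊔ G)`, and `y_F * y_G = 0` otherwise. -/
def mulLinear (L : Type u) [Lattice L] : (L →₀ ℤ) →ₗ[ℤ] (L →₀ ℤ) →ₗ[ℤ] (L →₀ ℤ) :=
  Finsupp.linearCombination ℤ fun F => Finsupp.linearCombination ℤ fun G =>
    if rk F + rk G = rk (F ⊔ G) then Finsupp.single (F ⊔ G) (1 : ℤ) else 0

theorem mulLinear_single (F G : L) (a b : ℤ) :
    mulLinear L (Finsupp.single F a) (Finsupp.single G b) =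
      if rk F + rk G = rk (F ⊔ G) then Finsupp.single (F ⊔ G) (a * b) else 0 := by
  simp only [mulLinear, Finsupp.linearCombination_single, LinearMap.smul_apply]
  split_ifs <;> simp

theorem mulLinear_comm (x y : L →₀ ℤ) : mulLinear L x y = mulLinear L y x := by
  induction x using Finsupp.induction_linear with
  | zero => simp
  | add p q hp hq => simp [hp, hq]
  | single F a =>
    induction y using Finsupp.induction_linear with
    | zero => simp
    | add p q hp hq => simp [hp, hq]
    | single G b =>
      rw [mulLinear_single, mulLinear_single, sup_comm, add_comm, mul_comm]

variable [OrderBot L]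

theorem mulLinear_one (x : L →₀ ℤ) : mulLinear L (Finsupp.single ⊥ 1) x = x := by
  induction x using Finsupp.induction_linear with
  | zero => simp
  | add p q hp hq => simp [hp, hq]
  | single F a =>
    rw [mulLinear_single]
    simp [rk]

variable [IsMatroidLattice L]

theorem rk_sup_le (F G : L) : rk (F ⊔ G) ≤ rk F + rk G :=
  le_trans (Nat.le_add_right _ _) (IsMatroidLattice.submodular F G)

theorem mulLinear_assoc (x y z : L →₀ ℤ) :
    mulLinear L (mulLinear L x y) z = mulLinear L x (mulLinear L y z) := by
  induction x using Finsupp.induction_linear with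
  | zero => simp
  | add p q hp hq => simp [hp, hq]
  | single F a =>
    induction y using Finsupp.induction_linear with
    | zero => simp
    | add p q hp hq => simp [hp, hq]
    | single G b =>
      induction z using Finsupp.induction_linear with
      | zero => simp
      | add p q hp hq => simp [hp, hq]
      | single K c =>
        have h1 := rk_sup_le F G
        have h2 := rk_sup_le G K
        have h3 := rk_sup_le (F ⊔ G) K
        have h4 := rk_sup_le F (G ⊔ K)
        rw [sup_assoc] at h3
        rw [mulLinear_single, mulLinear_single]
        by_cases e1 : rk F + rk G = rk (F ⊔ G)
        · by_cases e2 : rk G + rk K = rk (G ⊔ K)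
          · rw [if_pos e1, if_pos e2, mulLinear_single, mulLinear_single, sup_assoc, mul_assoc]
            exact if_congr (by omega) rfl rfl
          · rw [if_pos e1, if_neg e2, mulLinear_single, sup_assoc, if_neg (by omega), map_zero]
        · by_cases e2 : rk G + rk K = rk (G ⊔ K)
          · rw [if_neg e1, if_pos e2, mulLinear_single, if_neg (by omega), map_zero,
              LinearMap.zero_apply]
          · rw [if_neg e1, if_neg e2, map_zero, map_zero, LinearMap.zero_apply]

/-- The ring structure of the graded Möbius algebra, with unit `y_⊥`. -/
instance : CommRing (GradedMoebiusAlgebra L) :=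
  { (inferInstance : AddCommGroup (GradedMoebiusAlgebra L)) with
    mul := fun x z => mulLinear L x z
    one := y ⊥
    mul_assoc := mulLinear_assoc
    mul_comm := mulLinear_comm
    one_mul := mulLinear_one
    mul_one := fun x => (mulLinear_comm _ _).trans (mulLinear_one x)
    zero_mul := fun x => LinearMap.map_zero₂ (mulLinear L) x
    mul_zero := fun x => map_zero (mulLinear L x)
    left_distrib := fun x p q => map_add (mulLinear L x) p q
    right_distrib := fun p q x => LinearMap.map_add₂ (mulLinear L) p q x }

theorem y_mul_y (F G : L) :
    (y F * y G : GradedMoebiusAlgebra L) = if rk F + rk G = rk (F ⊔ G) then y (F ⊔ G) else 0 :=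
  mulLinear_single F G 1 1

end GradedMoebiusAlgebra

end GradedMoebius

end MatroidChow

end

noncomputable section

namespace MatroidChow

open MvPolynomial

universe v

section Rank

variable {L : Type v} [Lattice L] [OrderBot L]

theorem rk_bot : rk (⊥ : L) = 0 := by simp [rk]

variable [IsMatroidLattice L]

theorem height_lt_top (F : L) : Order.height F < ⊤ := by
  have := IsMatroidLattice.finite (L := L)
  have := Fintype.ofFinite L
  refine lt_of_le_of_lt (Order.height_le (n := (Fintype.card L : ℕ∞)) fun p _ => ?_)
    (ENat.natCast_lt_top _)
  exact_mod_cast p.length_lt_card.le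

theorem coe_rk (F : L) : (rk F : ℕ∞) = Order.height F :=
  ENat.natCast_toNat (height_lt_top F).ne

theorem rk_mono {F G : L} (hFG : F ≤ G) : rk F ≤ rk G := by
  have := Order.height_mono hFG
  rw [← coe_rk, ← coe_rk] at this
  exact_mod_cast this

theorem rk_lt_rk {F G : L} (hFG : F < G) : rk F < rk G := by
  have := Order.height_strictMono hFG (height_lt_top F)
  rw [← coe_rk, ← coe_rk] at this
  exact_mod_cast this

theorem rk_atom {a : L} (ha : IsAtom a) : rk a = 1 := by
  have h0 : rk (⊥ : L) < rk a := rk_lt_rk ha.bot_lt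
  have h1 : Order.height a ≤ (1 : ℕ) := by
    rw [Order.height_le_coe_iff]
    intro y hy
    rw [ha.2 y hy]
    simp
  rw [← coe_rk] at h1
  have : rk a ≤ 1 := by exact_mod_cast h1
  omega

theorem rk_sup_atom {F a : L} (ha : IsAtom a) (haF : ¬ a ≤ F) : rk (F ⊔ a) = rk F + 1 := by
  have h1 := GradedMoebiusAlgebra.rk_sup_le F a
  rw [rk_atom ha] at h1
  have h2 : rk F < rk (F ⊔ a) := rk_lt_rk (left_lt_sup.mpr haF)
  omega

theorem exists_atom_of_lt {F G : L} (hFG : F < G) : ∃ a, IsAtom a ∧ a ≤ G ∧ ¬ a ≤ F := by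
  by_contra! hc
  exact hFG.not_ge (le_iff_atom_le_imp.mpr fun a ha haG => hc a ha haG)

/-- Every flat is reached from `⊥` by successively adjoining atoms not yet contained. -/
theorem flat_induction {P : L → Prop} (bot : P ⊥)
    (step : ∀ F a, IsAtom a → ¬ a ≤ F → P F → P (F ⊔ a)) (F : L) : P F := by
  have := IsMatroidLattice.finite (L := L)
  obtain ⟨G, hG⟩ := Set.Finite.exists_maximal (s := {G : L | G ≤ F ∧ P G}) (Set.toFinite _)
    ⟨⊥, bot_le, bot⟩
  rcases hG.prop.1.eq_or_lt with h | h
  · exact h ▸ hG.prop.2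
  · obtain ⟨a, ha, haF, haG⟩ := exists_atom_of_lt h
    exact absurd (hG.le_of_ge ⟨sup_le hG.prop.1 haF, step G a ha haG hG.prop.2⟩ le_sup_left)
      fun hc => haG (le_sup_right.trans hc)

end Rank

section Relations

variable {L : Type v} [Lattice L] [OrderBot L]

theorem mk_eq_zero {p : MvPolynomial (NonemptyFlat L) ℤ} (hp : AugmentedChowRel L p) :
    Ideal.Quotient.mk (Ideal.span {p | AugmentedChowRel L p}) p = 0 :=
  Ideal.Quotient.eq_zero_iff_mem.mpr (Ideal.subset_span hp)

open scoped Classical in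
/-- The generator `h_F`, extended by `0` to `F = ⊥`. -/
def h₀ (F : L) : AugmentedChowRing L := if hF : F = ⊥ then 0 else h ⟨F, hF⟩

theorem h₀_bot : h₀ (⊥ : L) = 0 := dif_pos rfl

theorem h₀_coe (F : NonemptyFlat L) : h₀ F.1 = h F := dif_neg F.2

theorem h₀_join (F G : L) : (h₀ F - h₀ (F ⊔ G)) * (h₀ G - h₀ (F ⊔ G)) = 0 := by
  by_cases hF : F = ⊥
  · simp [hF]
  by_cases hG : G = ⊥
  · simp [hG]
  have := mk_eq_zero (AugmentedChowRel.join (⟨F, hF⟩ : NonemptyFlat L) ⟨G, hG⟩)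
  rw [map_mul, map_sub, map_sub] at this
  change (h _ - h _) * (h _ - h _) = 0 at this
  rw [← h₀_coe, ← h₀_coe, ← h₀_coe] at this
  rwa [sup_comm F G]

theorem h₀_atom_sq {a : L} (ha : IsAtom a) : h₀ a * h₀ a = 0 := by
  have := mk_eq_zero (AugmentedChowRel.atom_sq (⟨a, ha.ne_bot⟩ : NonemptyFlat L) ha)
  rw [map_pow] at this
  change h _ ^ 2 = 0 at this
  rwa [← h₀_coe, pow_two] at this

theorem h₀_atom_mul {a : L} (ha : IsAtom a) (F : L) : h₀ a * h₀ F = h₀ a * h₀ (F ⊔ a) := by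
  by_cases hF : F = ⊥
  · simp [hF, h₀_bot, h₀_atom_sq ha]
  have := mk_eq_zero
    (AugmentedChowRel.atom_mul (⟨a, ha.ne_bot⟩ : NonemptyFlat L) ha ⟨F, hF⟩)
  rw [map_sub, map_mul, map_mul, sub_eq_zero] at this
  change h _ * h _ = h _ * h _ at this
  rwa [← h₀_coe, ← h₀_coe, ← h₀_coe] at this

theorem h₀_mul_sup_atom {a : L} (ha : IsAtom a) (F : L) :
    h₀ (F ⊔ a) * h₀ F = h₀ (F ⊔ a) * h₀ (F ⊔ a) := by
  linear_combination -h₀_join F a + h₀_atom_mul ha F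

theorem h₀_pow_mul_sup_atom {a : L} (ha : IsAtom a) (F : L) (n : ℕ) :
    h₀ F ^ n * h₀ (F ⊔ a) = h₀ (F ⊔ a) ^ (n + 1) := by
  induction n with
  | zero => simp
  | succ n ih =>
    rw [pow_succ (h₀ F), mul_assoc, mul_comm (h₀ F), h₀_mul_sup_atom ha, ← mul_assoc, ih,
      ← pow_succ]

theorem hPow_bot : hPow (⊥ : L) = 1 := dif_pos rfl

theorem hPow_eq (F : L) : hPow F = h₀ F ^ rk F := by
  by_cases hF : F = ⊥
  · simp [hPow, hF, rk_bot]
  · simp [hPow, h₀, hF]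

variable [IsMatroidLattice L]

theorem hPow_atom {a : L} (ha : IsAtom a) : hPow a = h₀ a := by
  rw [hPow_eq, rk_atom ha, pow_one]

theorem hPow_mul_sup_atom {F a : L} (ha : IsAtom a) (haF : ¬ a ≤ F) :
    hPow F * h₀ (F ⊔ a) = hPow (F ⊔ a) := by
  rw [hPow_eq, hPow_eq, rk_sup_atom ha haF, h₀_pow_mul_sup_atom ha]

theorem hPow_mul_h₀ (F : L) : ∀ K : L, hPow F * h₀ K = hPow F * h₀ (F ⊔ K) := by
  induction F using flat_induction with
  | bot => simp
  | step F a ha haF ih =>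
    intro K
    rw [← hPow_mul_sup_atom ha haF, ← ih a, mul_assoc, mul_assoc, h₀_atom_mul ha K,
      sup_assoc, sup_comm a K, mul_left_comm, ih (K ⊔ a), mul_left_comm]

theorem hPow_mul_atom {F a : L} (ha : IsAtom a) (haF : ¬ a ≤ F) :
    hPow F * h₀ a = hPow (F ⊔ a) := by
  rw [hPow_mul_h₀, hPow_mul_sup_atom ha haF]

theorem hPow_mul_atom_of_le {a : L} (ha : IsAtom a) (F : L) :
    a ≤ F → hPow F * h₀ a = 0 := by
  induction F using flat_induction with
  | bot => exact fun hle => absurd (le_bot_iff.mp hle) ha.ne_bot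
  | step F b hb hbF ih =>
    intro hle
    by_cases haF : a ≤ F
    · rw [← hPow_mul_atom hb hbF, mul_right_comm, ih haF, zero_mul]
    · have heq : F ⊔ a = F ⊔ b := by
        refine (sup_le le_sup_left hle).eq_of_not_lt fun hlt => ?_
        have := rk_lt_rk hlt
        rw [rk_sup_atom ha haF, rk_sup_atom hb hbF] at this
        omega
      rw [← heq, ← hPow_mul_atom ha haF, mul_assoc, h₀_atom_sq ha, mul_zero]

end Relations

section HallRado

variable {L : Type v} [Lattice L] [OrderBot L]

/-- The join of the flats in a multiset. -/
def spanJoin (J : NonemptyFlat L →₀ ℕ) : L := J.support.sup Subtype.val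

/-- `Slack m S n` says that `rk (S ⊔ ⋁ J) ≥ |J| + n` for all submultisets `J` of `m`. For `S = ⊥`
and `n = 0` this is the Hall–Rado condition on `m`; otherwise it says that `S` has rank at least
`n` in the iterated principal truncation at `m`. -/
def Slack (m : NonemptyFlat L →₀ ℕ) (S : L) (n : ℕ) : Prop :=
  ∀ J ≤ m, J.degree + n ≤ rk (S ⊔ spanJoin J)

theorem spanJoin_add (J K : NonemptyFlat L →₀ ℕ) :
    spanJoin (J + K) = spanJoin J ⊔ spanJoin K := by
  classical
  have : (J + K).support = J.support ∪ K.support := by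
    ext x
    simp only [Finsupp.mem_support_iff, Finsupp.add_apply, Finset.mem_union]
    omega
  rw [spanJoin, this, Finset.sup_union, spanJoin, spanJoin]

theorem spanJoin_single (F : NonemptyFlat L) {n : ℕ} (hn : n ≠ 0) :
    spanJoin (Finsupp.single F n) = F.1 := by
  rw [spanJoin, Finsupp.support_single F hn, Finset.sup_singleton]

theorem spanJoin_mono {J K : NonemptyFlat L →₀ ℕ} (hJK : J ≤ K) : spanJoin J ≤ spanJoin K :=
  Finset.sup_mono (Finsupp.support_mono hJK)

theorem slack_add_single (m : NonemptyFlat L →₀ ℕ) (F : NonemptyFlat L) (S : L) (n : ℕ) :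
    Slack (m + Finsupp.single F 1) S n ↔ Slack m S n ∧ Slack m (S ⊔ F.1) (n + 1) := by
  constructor
  · intro hs
    refine ⟨fun J hJ => hs J (hJ.trans le_self_add), fun J hJ => ?_⟩
    have := hs (J + Finsupp.single F 1) (by gcongr)
    rw [spanJoin_add, spanJoin_single F one_ne_zero, map_add, Finsupp.degree_single,
      sup_comm (spanJoin J), ← sup_assoc] at this
    omega
  · rintro ⟨h1, h2⟩ J hJ
    have hJ' : J - Finsupp.single F 1 ≤ m := tsub_le_iff_right.mpr hJ
    by_cases hF : J F = 0
    · refine h1 J (le_of_eq_of_le ?_ hJ')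
      ext x
      by_cases hx : F = x
      · subst hx; simp [hF]
      · simp [hx]
    · have hle : Finsupp.single F 1 ≤ J := by
        rw [Finsupp.single_le_iff]
        omega
      have := h2 _ hJ'
      rw [← tsub_add_cancel_of_le hle, spanJoin_add, spanJoin_single F one_ne_zero, map_add,
        Finsupp.degree_single, sup_comm (spanJoin _), ← sup_assoc]
      omega

theorem slack_single (F : NonemptyFlat L) : Slack (Finsupp.single F (rk F.1)) ⊥ 0 := by
  intro J hJ
  have hJF : J = Finsupp.single F (J F) :=
    Finsupp.support_subset_singleton.mp
      ((Finsupp.support_mono hJ).trans Finsupp.support_single_subset)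
  have hle : J F ≤ rk F.1 := by simpa using hJ F
  by_cases h0 : J F = 0
  · rw [h0, Finsupp.single_zero] at hJF
    simp [hJF]
  · rw [hJF, Finsupp.degree_single, spanJoin_single F h0, bot_sup_eq]
    exact hle

open scoped Classical in
/-- The functional on polynomials taking a monomial to `1` if it satisfies the Hall–Rado condition
and to `0` otherwise. -/
def hallRadoFunctional (L : Type v) [Lattice L] [OrderBot L] :
    MvPolynomial (NonemptyFlat L) ℤ →ₗ[ℤ] ℤ :=
  (basisMonomials (NonemptyFlat L) ℤ).constr ℤ fun m => if Slack m ⊥ 0 then 1 else 0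

open scoped Classical in
theorem hallRadoFunctional_monomial (m : NonemptyFlat L →₀ ℕ) :
    hallRadoFunctional L (monomial m 1) = if Slack m ⊥ 0 then 1 else 0 := by
  rw [hallRadoFunctional, ← congrFun (coe_basisMonomials (NonemptyFlat L) ℤ) m,
    Module.Basis.constr_basis]

open scoped Classical in
theorem hallRadoFunctional_monomial_mul (m : NonemptyFlat L →₀ ℕ) (F G : NonemptyFlat L) :
    hallRadoFunctional L (monomial m 1 * (X F * X G)) =
      if Slack m ⊥ 0 ∧ Slack m F.1 1 ∧ Slack m G.1 1 ∧ Slack m (F.1 ⊔ G.1) 2 then 1 else 0 := by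
  have : (monomial m 1 * (X F * X G) : MvPolynomial (NonemptyFlat L) ℤ) =
      monomial (m + Finsupp.single G 1 + Finsupp.single F 1) 1 := by
    simp only [X, monomial_mul, mul_one, add_assoc, add_comm (Finsupp.single G 1)]
  rw [this, hallRadoFunctional_monomial]
  refine if_congr ?_ rfl rfl
  simp only [slack_add_single, bot_sup_eq, zero_add]
  tauto

variable [IsMatroidLattice L]

theorem Slack.mono {m : NonemptyFlat L →₀ ℕ} {S T : L} {n k : ℕ} (hs : Slack m S n)
    (hST : S ≤ T) (hk : k ≤ n) : Slack m T k := fun J hJ =>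
  (Nat.add_le_add_left hk _).trans ((hs J hJ).trans (rk_mono (sup_le_sup_right hST _)))

/-- Subadditivity of the rank in an iterated principal truncation. -/
theorem Slack.sup {m : NonemptyFlat L →₀ ℕ} (hm : Slack m ⊥ 0) {S T : L} {p q : ℕ}
    (hs : Slack m (S ⊔ T) (p + q + 1)) : Slack m S (p + 1) ∨ Slack m T (q + 1) := by
  classical
  by_contra! hc
  simp only [Slack, not_forall, not_le] at hc
  obtain ⟨⟨J, hJ, hJ'⟩, K, hK, hK'⟩ := hc
  have h1 := hs (J ⊔ K) (sup_le hJ hK)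
  have h2 := hm (J ⊓ K) (inf_le_left.trans hJ)
  have h3 := IsMatroidLattice.submodular (S ⊔ spanJoin J) (T ⊔ spanJoin K)
  have h4 : rk (⊥ ⊔ spanJoin (J ⊓ K)) ≤ rk ((S ⊔ spanJoin J) ⊓ (T ⊔ spanJoin K)) := by
    refine rk_mono (sup_le bot_le (le_inf ?_ ?_))
    · exact (spanJoin_mono inf_le_left).trans le_sup_right
    · exact (spanJoin_mono inf_le_right).trans le_sup_right
  have h5 : rk (S ⊔ T ⊔ spanJoin (J ⊔ K)) ≤ rk (S ⊔ spanJoin J ⊔ (T ⊔ spanJoin K)) := by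
    refine rk_mono ?_
    rw [sup_sup_sup_comm, spanJoin, Finsupp.support_sup, Finset.sup_union, spanJoin, spanJoin]
  have h6 : (J ⊔ K).degree + (J ⊓ K).degree = J.degree + K.degree := by
    rw [← map_add, ← map_add]
    congr 1
    ext x
    simp only [Finsupp.add_apply, Finsupp.sup_apply, Finsupp.inf_apply]
    exact max_add_min _ _
  omega

theorem hallRadoFunctional_mul_rel (m : NonemptyFlat L →₀ ℕ)
    {p : MvPolynomial (NonemptyFlat L) ℤ} (hp : AugmentedChowRel L p) :
    hallRadoFunctional L (monomial m 1 * p) = 0 := by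
  classical
  cases hp with
  | join F G =>
    have hH : (G.join F).1 = F.1 ⊔ G.1 := sup_comm _ _
    have key : Slack m ⊥ 0 → Slack m (F.1 ⊔ G.1) 2 →
        (Slack m F.1 1 ∨ Slack m G.1 1) ∧ Slack m (F.1 ⊔ G.1) 1 := fun hm hs =>
      ⟨(Slack.sup hm (p := 0) (q := 1) hs).imp_right fun h => h.mono le_rfl one_le_two,
        hs.mono le_rfl one_le_two⟩
    have : (monomial m 1 * ((X F - X (G.join F)) * (X G - X (G.join F))) :
        MvPolynomial (NonemptyFlat L) ℤ) = monomial m 1 * (X F * X G)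
          - monomial m 1 * (X F * X (G.join F)) - monomial m 1 * (X G * X (G.join F))
          + monomial m 1 * (X (G.join F) * X (G.join F)) := by ring
    rw [this, map_add, map_sub, map_sub]
    simp only [hallRadoFunctional_monomial_mul, sup_idem, hH]
    by_cases h0 : Slack m ⊥ 0 <;> by_cases h2 : Slack m (F.1 ⊔ G.1) 2
    · obtain ⟨h3, h4⟩ := key h0 h2
      by_cases hF : Slack m F.1 1 <;> by_cases hG : Slack m G.1 1 <;> simp_all
    all_goals simp [h0, h2]
  | atom_sq a ha =>
    rw [pow_two, hallRadoFunctional_monomial_mul, if_neg]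
    rintro ⟨-, -, -, hs⟩
    have := hs 0 zero_le
    simp [spanJoin, rk_atom ha] at this
  | atom_mul a ha F =>
    have hH : (F.join a).1 = F.1 ⊔ a.1 := rfl
    rw [mul_sub, map_sub, hallRadoFunctional_monomial_mul, hallRadoFunctional_monomial_mul,
      sub_eq_zero]
    refine if_congr ?_ rfl rfl
    rw [hH, sup_comm F.1, ← sup_assoc, sup_idem]
    refine and_congr_right fun hm => and_congr_right fun h1 => and_congr_left fun h2 =>
      ⟨fun hF => hF.mono le_sup_right le_rfl, fun _ => ?_⟩
    refine (Slack.sup hm (p := 1) (q := 0) h2).resolve_left fun hs => ?_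
    have := hs 0 zero_le
    simp [spanJoin, rk_atom ha] at this

theorem hallRadoFunctional_eq_zero {p : MvPolynomial (NonemptyFlat L) ℤ}
    (hp : p ∈ Ideal.span {p | AugmentedChowRel L p}) : hallRadoFunctional L p = 0 := by
  have key : ∀ q : MvPolynomial (NonemptyFlat L) ℤ, hallRadoFunctional L (q * p) = 0 := by
    induction hp using Submodule.span_induction with
    | mem p hp =>
      intro q
      induction q using MvPolynomial.induction_on' with
      | monomial m c =>
        have : (monomial m c : MvPolynomial (NonemptyFlat L) ℤ) = c • monomial m 1 := by
          rw [smul_monomial, smul_eq_mul, mul_one]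
        rw [this, smul_mul_assoc, map_smul, hallRadoFunctional_mul_rel m hp, smul_zero]
      | add q r hq hr => rw [add_mul, map_add, hq, hr, add_zero]
    | zero => simp
    | add p q _ _ hp hq => intro r; rw [mul_add, map_add, hp, hq, add_zero]
    | smul c p _ hp => intro r; rw [smul_eq_mul, ← mul_assoc, hp]
  simpa using key 1

/-- The functional on the augmented Chow ring induced by `hallRadoFunctional`. -/
def chowFunctional (L : Type v) [Lattice L] [OrderBot L] [IsMatroidLattice L] :
    AugmentedChowRing L →+ ℤ :=
  QuotientAddGroup.lift (Ideal.span {p | AugmentedChowRel L p}).toAddSubgroup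
    (hallRadoFunctional L).toAddMonoidHom fun _ hp => hallRadoFunctional_eq_zero hp

theorem chowFunctional_mk (p : MvPolynomial (NonemptyFlat L) ℤ) :
    chowFunctional L (Ideal.Quotient.mk _ p) = hallRadoFunctional L p := rfl

theorem chowFunctional_hPow (F : L) : chowFunctional L (hPow F) = 1 := by
  by_cases hF : F = ⊥
  · subst hF
    rw [hPow_bot, ← map_one (Ideal.Quotient.mk _), chowFunctional_mk, ← C_1, C_apply,
      hallRadoFunctional_monomial, if_pos]
    intro J hJ
    simp [le_antisymm hJ zero_le]
  · rw [hPow, dif_neg hF, h, ← map_pow, chowFunctional_mk, X_pow_eq_monomial,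
      hallRadoFunctional_monomial, if_pos (slack_single ⟨F, hF⟩)]

end HallRado

section Independence

variable {L : Type v} [Lattice L] [OrderBot L]

open scoped Classical in
/-- The endomorphism of the augmented Chow ring which keeps `h_F` for `F ≤ G` and kills the other
generators. -/
def restrict (G : L) : AugmentedChowRing L →+* AugmentedChowRing L :=
  Ideal.Quotient.lift _
    (aeval (R := ℤ) fun F : NonemptyFlat L => if F.1 ≤ G then h F else 0).toRingHom <| by
    intro p hp
    refine (Ideal.span_le (I := RingHom.ker _)).mpr ?_ hp
    rintro p hp
    simp only [SetLike.mem_coe, RingHom.mem_ker, AlgHom.toRingHom_eq_coe, RingHom.coe_coe]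
    cases hp with
    | join F K =>
      have hH : (K.join F).1 = F.1 ⊔ K.1 := sup_comm _ _
      have := h₀_join F.1 K.1
      rw [← hH, h₀_coe, h₀_coe, h₀_coe] at this
      simp only [map_mul, map_sub, aeval_X, hH, sup_le_iff]
      by_cases hF : F.1 ≤ G <;> by_cases hK : K.1 ≤ G <;> simp [hF, hK, this]
    | atom_sq a ha =>
      have := h₀_atom_sq ha
      rw [h₀_coe] at this
      simp only [map_pow, aeval_X]
      split_ifs <;> simp [pow_two, this]
    | atom_mul a ha F =>
      have hH : (F.join a).1 = F.1 ⊔ a.1 := rfl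
      have := h₀_atom_mul ha F.1
      rw [← hH, h₀_coe, h₀_coe, h₀_coe] at this
      simp only [map_mul, map_sub, aeval_X, hH, sup_le_iff]
      by_cases hF : F.1 ≤ G <;> by_cases hK : a.1 ≤ G <;> simp [hF, hK, this]

open scoped Classical in
theorem restrict_h (G : L) (F : NonemptyFlat L) :
    restrict G (h F) = if F.1 ≤ G then h F else 0 := by
  exact aeval_X _ F

variable [IsMatroidLattice L]

open scoped Classical in
theorem restrict_hPow (G F : L) : restrict G (hPow F) = if F ≤ G then hPow F else 0 := by
  by_cases hF : F = ⊥
  · simp [hF, hPow_bot]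
  · have : rk F ≠ 0 := by
      have := rk_lt_rk (bot_lt_iff_ne_bot.mpr hF)
      omega
    rw [hPow, dif_neg hF, map_pow, restrict_h]
    split_ifs <;> simp [this]

theorem linearIndependent_hPow : LinearIndependent ℤ (hPow : L → AugmentedChowRing L) := by
  classical
  rw [linearIndependent_iff]
  intro c hc
  by_contra hne
  obtain ⟨G, hG⟩ := c.support.exists_minimal (Finsupp.support_nonempty_iff.mpr hne)
  have h1 : chowFunctional L (restrict G (Finsupp.linearCombination ℤ hPow c)) = c G := by
    rw [Finsupp.linearCombination_apply, Finsupp.sum, map_sum, map_sum,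
      Finset.sum_eq_single_of_mem G hG.prop]
    · rw [map_zsmul, map_zsmul, restrict_hPow, if_pos le_rfl, chowFunctional_hPow, smul_eq_mul,
        mul_one]
    · intro F hF hFG
      rw [map_zsmul, restrict_hPow, if_neg, smul_zero, map_zero]
      exact fun hle => hFG (hG.eq_of_le hF hle)
  rw [hc, map_zero, map_zero] at h1
  exact Finsupp.mem_support_iff.mp hG.prop h1.symm

end Independence

namespace GradedMoebiusAlgebra

variable {L : Type v} [Lattice L] [OrderBot L] [IsMatroidLattice L]

/-- The additive map sending `y_F` to `h_F ^ rk F`. -/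
def toChowAddHom (L : Type v) [Lattice L] [OrderBot L] [IsMatroidLattice L] :
    GradedMoebiusAlgebra L →+ AugmentedChowRing L :=
  (Finsupp.linearCombination ℤ (hPow : L → AugmentedChowRing L)).toAddMonoidHom

theorem toChowAddHom_y (F : L) : toChowAddHom L (y F) = hPow F :=
  (Finsupp.linearCombination_single ℤ 1 F).trans (one_smul _ _)

theorem toChowAddHom_injective : Function.Injective (toChowAddHom L) :=
  linearIndependent_hPow

theorem y_mul_atom {F a : L} (ha : IsAtom a) (haF : ¬ a ≤ F) : y F * y a = y (F ⊔ a) := by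
  rw [y_mul_y, if_pos (by rw [rk_atom ha, rk_sup_atom ha haF])]

theorem y_mul_atom_of_le {F a : L} (ha : IsAtom a) (haF : a ≤ F) : y F * y a = 0 := by
  rw [y_mul_y, if_neg (fun he => by rw [rk_atom ha, sup_eq_left.mpr haF] at he; omega)]

theorem y_bot : y (⊥ : L) = 1 := rfl

theorem additive_induction {P : GradedMoebiusAlgebra L → Prop} (hy : ∀ F, P (y F))
    (zero : P 0) (add : ∀ x z, P x → P z → P (x + z)) (neg : ∀ x, P x → P (-x))
    (x : GradedMoebiusAlgebra L) : P x := by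
  have hx : x ∈ AddSubgroup.closure (Set.range (y : L → GradedMoebiusAlgebra L)) := by
    refine Finsupp.induction_linear (motive := fun x : L →₀ ℤ =>
      (x : GradedMoebiusAlgebra L) ∈ AddSubgroup.closure (Set.range y)) x (zero_mem _)
      (fun p q hp hq => add_mem hp hq) fun F c => ?_
    have : (Finsupp.single F c : L →₀ ℤ) = c • Finsupp.single F 1 := by simp
    rw [this]
    exact zsmul_mem (AddSubgroup.subset_closure (Set.mem_range_self F)) c
  induction hx using AddSubgroup.closure_induction with
  | mem x hx => obtain ⟨F, rfl⟩ := hx; exact hy F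
  | zero => exact zero
  | add x z _ _ hx hz => exact add x z hx hz
  | neg x _ hx => exact neg x hx

theorem toChowAddHom_mul_atom {a : L} (ha : IsAtom a) (x : GradedMoebiusAlgebra L) :
    toChowAddHom L (x * y a) = toChowAddHom L x * h₀ a := by
  induction x using additive_induction with
  | hy F =>
    rw [toChowAddHom_y]
    by_cases haF : a ≤ F
    · rw [y_mul_atom_of_le ha haF, map_zero, hPow_mul_atom_of_le ha F haF]
    · rw [y_mul_atom ha haF, toChowAddHom_y, hPow_mul_atom ha haF]
  | zero => simp
  | add x z hx hz => rw [add_mul, map_add, hx, hz, map_add, add_mul]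
  | neg x hx =>
    rw [neg_mul, map_neg, hx, map_neg]
    exact (neg_mul (toChowAddHom L x) (h₀ a)).symm

theorem toChowAddHom_mul_y (F : L) (x : GradedMoebiusAlgebra L) :
    toChowAddHom L (x * y F) = toChowAddHom L x * hPow F := by
  induction F using flat_induction with
  | bot => rw [y_bot, hPow_bot, mul_one, mul_one]
  | step F a ha haF ih =>
    rw [← y_mul_atom ha haF, ← mul_assoc, toChowAddHom_mul_atom ha, ih, mul_assoc,
      hPow_mul_atom ha haF]

/-- The ring homomorphism sending `y_F` to `h_F ^ rk F`. -/
def toChow (L : Type v) [Lattice L] [OrderBot L] [IsMatroidLattice L] :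
    GradedMoebiusAlgebra L →+* AugmentedChowRing L :=
  { toChowAddHom L with
    map_one' := (toChowAddHom_y ⊥).trans hPow_bot
    map_mul' := fun x z => by
      change toChowAddHom L (x * z) = toChowAddHom L x * toChowAddHom L z
      induction z using additive_induction with
      | hy F => rw [toChowAddHom_mul_y, toChowAddHom_y]
      | zero => simp
      | add z w hz hw => rw [mul_add, map_add, hz, hw, map_add, mul_add]
      | neg z hz =>
        rw [mul_neg, map_neg, hz, map_neg]
        exact (mul_neg (toChowAddHom L x) (toChowAddHom L z)).symm }

theorem toChow_y (F : L) : toChow L (y F) = hPow F := toChowAddHom_y F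

theorem toChow_injective : Function.Injective (toChow L) := toChowAddHom_injective

/-- The graded Möbius algebra is generated by the `y_a` for atoms `a`. -/
theorem ringHom_ext_atom {R : Type*} [Ring R] {φ ψ : GradedMoebiusAlgebra L →+* R}
    (hφψ : ∀ a : L, IsAtom a → φ (y a) = ψ (y a)) : φ = ψ := by
  ext x
  induction x using additive_induction with
  | hy F =>
    induction F using flat_induction with
    | bot => rw [y_bot, map_one, map_one]
    | step F a ha haF ih => rw [← y_mul_atom ha haF, map_mul, map_mul, ih, hφψ a ha]
  | zero => simp
  | add x z hx hz => rw [map_add, map_add, hx, hz]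
  | neg x hx => rw [map_neg, map_neg, hx]

/-- The basis `h_F ^ rk F` of the image of the graded Möbius algebra. -/
def rangeBasis (L : Type v) [Lattice L] [OrderBot L] [IsMatroidLattice L] :
    Module.Basis L ℤ (toChow L).range :=
  .ofRepr (RingEquiv.ofBijective (toChow L).rangeRestrict
    ⟨fun _ _ hxz => toChow_injective (congrArg Subtype.val hxz),
      (toChow L).rangeRestrict_surjective⟩).toAddEquiv.toIntLinearEquiv.symm

theorem coe_rangeBasis (F : L) : (rangeBasis L F : AugmentedChowRing L) = hPow F :=
  toChow_y F

end GradedMoebiusAlgebra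

end MatroidChow

end

theorem mainTheorem5 {L : Type*} [Lattice L] [OrderBot L] [MatroidChow.IsMatroidLattice L] :
    ∃ φ : MatroidChow.GradedMoebiusAlgebra L →+* MatroidChow.AugmentedChowRing L,
      (∀ (a : L) (ha : IsAtom a),
        φ (MatroidChow.GradedMoebiusAlgebra.y a) = MatroidChow.h ⟨a, ha.ne_bot⟩) ∧
      (∀ ψ : MatroidChow.GradedMoebiusAlgebra L →+* MatroidChow.AugmentedChowRing L,
        (∀ (a : L) (ha : IsAtom a),
          ψ (MatroidChow.GradedMoebiusAlgebra.y a) = MatroidChow.h ⟨a, ha.ne_bot⟩) → ψ = φ) ∧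
      Function.Injective φ ∧
      (∀ F : L, φ (MatroidChow.GradedMoebiusAlgebra.y F) = MatroidChow.hPow F) ∧
      ∃ b : Module.Basis L ℤ φ.range,
        ∀ F : L, (b F : MatroidChow.AugmentedChowRing L) = MatroidChow.hPow F := by
  have hatom (a : L) (ha : IsAtom a) :
      MatroidChow.GradedMoebiusAlgebra.toChow L (MatroidChow.GradedMoebiusAlgebra.y a) =
        MatroidChow.h ⟨a, ha.ne_bot⟩ := by
    rw [MatroidChow.GradedMoebiusAlgebra.toChow_y, MatroidChow.hPow_atom ha]
    exact MatroidChow.h₀_coe ⟨a, ha.ne_bot⟩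
  exact ⟨MatroidChow.GradedMoebiusAlgebra.toChow L, hatom,
    fun ψ hψ => MatroidChow.GradedMoebiusAlgebra.ringHom_ext_atom fun a ha =>
      (hψ a ha).trans (hatom a ha).symm,
    MatroidChow.GradedMoebiusAlgebra.toChow_injective,
    MatroidChow.GradedMoebiusAlgebra.toChow_y,
    MatroidChow.GradedMoebiusAlgebra.rangeBasis L,
    MatroidChow.GradedMoebiusAlgebra.coe_rangeBasis⟩
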